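/- Let $n\ge 2$ and $p\in\mathbb N_0$. Let $\mathcal P^n$ be the set of nonempty convex polytopes in $\mathbb R^n$, $\mathcal B(\mathbb R^n)$ the Borel $\sigma$-algebra, $\mathbb T^p$ the real vector space of symmetric tensors of rank $p$ over $\mathbb R^n$ (symmetric $p$-linear maps $(\mathbb R^n)^p\to\mathbb R$, with vectors identified with linear forms via the scalar product), and let products and powers of tensors be symmetric tensor products. Let $Q\in\mathbb T^2$ be the metric tensor, $Q(x,y)=\langle x,y\rangle$, and for a face $F$ of a polytope let $Q(F)(x,y)=\langle p_Lx,p_Ly\rangle$, where $p_L$ is the orthogonal projection onto the direction space $L$ of the affine hull of $F$. Write $\mathcal F_j(P)$ for the set of $j$-dimensional faces of $P$, $N(P,F)$ for the normal cone of $P$ at $F$, $\mathcal H^k$ for the $k$-dimensional Hausdorff measure, and $\omega_k=2\pi^{k/2}/\Gamma(k/2)$. For $P\in\mathcal P^n$, $\beta\in\mathcal B(\mathbb R^n)$ and $r,s,l\in\mathbb N_0$, define for $j\in\{0,\dots,n-1\}$ $$\phi_j^{r,s,l}(P,\beta)=c_{n,j}^{r,s,l}\,\frac1{\omega_{n-j}}\sum_{F\in\mathcal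 F_j(P)}Q(F)^l\int_{F\cap\beta}x^r\,\mathcal H^j(dx)\int_{N(P,F)\cap\mathbb S^{n-1}}u^s\,\mathcal H^{n-j-1}(du),$$ where $c_{n,j}^{r,s,l}=\frac1{r!\,s!}\frac{\omega_{n-j}}{\omega_{n-j+s}}\frac{\omega_{j+2l}}{\omega_j}$ if $j\ne0$, $c_{n,0}^{r,s,0}=\frac1{r!\,s!}\frac{\omega_n}{\omega_{n+s}}$, and $c_{n,0}^{r,s,l}=1$ if $l\ge1$; and define $$\phi_n^{r,0,l}(P,\beta)=\frac1{r!}\frac{\omega_{n+2l}}{\omega_n}\,Q^l\int_{P\cap\beta}x^r\,\mathcal H^n(dx).$$ Then the maps $$Q^m\phi_j^{r,s,l}:\mathcal P^n\times\mathcal B(\mathbb R^n)\to\mathbb T^p,$$ indexed by all $m,r,s,l\in\mathbb N_0$ and $j\in\{0,\dots,n\}$ with $2m+2l+r+s=p$, where $l=0$ if $j\in\{0,n-1\}$, and $s=l=0$ if $j=n$, form a linearly independent family over $\mathbb R$. -/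

import Mathlib

open MeasureTheory
open scoped RealInnerProductSpace Nat

noncomputable section

namespace TensorCurv

/-- The Euclidean space `ℝⁿ`. -/
abbrev E (n : ℕ) : Type := EuclideanSpace ℝ (Fin n)

/-! ### Symmetric tensors -/

/-- `𝕋^p`: the vector space of symmetric tensors of rank `p` over `ℝⁿ`, that is, of the symmetric
`p`-linear maps `(ℝⁿ)^p → ℝ`. It carries the operator norm of multilinear maps (on a
finite-dimensional space any other norm would give the same integrals). -/
def SymTensor (n p : ℕ) :
    Submodule ℝ (ContinuousMultilinearMap ℝ (fun _ : Fin p => E n) ℝ) where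
  carrier := {T | ∀ (σ : Equiv.Perm (Fin p)) (v : Fin p → E n), T (fun i => v (σ i)) = T v}
  add_mem' := by
    intro a b ha hb σ v
    simp [ha σ v, hb σ v]
  zero_mem' := by
    intro σ v
    simp
  smul_mem' := by
    intro c a ha σ v
    simp [ha σ v]

/-- `𝕋^p` is complete, so that Bochner integrals with values in it are meaningful. -/
instance (n p : ℕ) : CompleteSpace (SymTensor n p) := by
  have hcl : IsClosed ((SymTensor n p : Submodule ℝ _) :
      Set (ContinuousMultilinearMap ℝ (fun _ : Fin p => E n) ℝ)) := by
    have : ((SymTensor n p : Submodule ℝ _) :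
        Set (ContinuousMultilinearMap ℝ (fun _ : Fin p => E n) ℝ)) =
        ⋂ (σ : Equiv.Perm (Fin p)), ⋂ (v : Fin p → E n), {T | T (fun i => v (σ i)) = T v} := by
      ext T
      simp [SymTensor]
    rw [this]
    refine isClosed_iInter fun σ => isClosed_iInter fun v => ?_
    exact isClosed_eq (ContinuousMultilinearMap.apply ℝ _ ℝ (fun i => v (σ i))).continuous
      (ContinuousMultilinearMap.apply ℝ _ ℝ v).continuous
  exact hcl.completeSpace_coe

/-- The (not symmetrized) tensor product `T ⊗ U` of multilinear forms:
`(T ⊗ U)(v₁, …, v_{p+q}) = T(v₁, …, v_p) U(v_{p+1}, …, v_{p+q})`. -/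
def tensorMul {n p q : ℕ} (T : ContinuousMultilinearMap ℝ (fun _ : Fin p => E n) ℝ)
    (U : ContinuousMultilinearMap ℝ (fun _ : Fin q => E n) ℝ) :
    ContinuousMultilinearMap ℝ (fun _ : Fin (p + q) => E n) ℝ where
  toMultilinearMap :=
    ((LinearMap.mul' ℝ ℝ).compMultilinearMap
      (T.toMultilinearMap.domCoprod U.toMultilinearMap)).domDomCongr finSumFinEquiv
  cont := by
    change Continuous fun v : Fin (p + q) → E n =>
      T (fun i => v (finSumFinEquiv (Sum.inl i))) * U (fun i => v (finSumFinEquiv (Sum.inr i)))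
    fun_prop

theorem tensorMul_apply {n p q : ℕ} (T : ContinuousMultilinearMap ℝ (fun _ : Fin p => E n) ℝ)
    (U : ContinuousMultilinearMap ℝ (fun _ : Fin q => E n) ℝ) (v : Fin (p + q) → E n) :
    tensorMul T U v = T (fun i => v (Fin.castAdd q i)) * U (fun i => v (Fin.natAdd p i)) :=
  rfl

/-- The symmetric tensor product `T U ∈ 𝕋^{p+q}` of `T ∈ 𝕋^p` and `U ∈ 𝕋^q`: the average of
`T ⊗ U` over all permutations of the `p + q` arguments. -/
def symMul {n p q : ℕ} (T : SymTensor n p) (U : SymTensor n q) : SymTensor n (p + q) where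
  val := (((p + q)! : ℝ))⁻¹ •
    ∑ σ : Equiv.Perm (Fin (p + q)), (tensorMul T.1 U.1).domDomCongr σ
  property := by
    intro τ v
    simp only [smul_apply, sum_apply,
      ContinuousMultilinearMap.domDomCongr_apply]
    congr 1
    exact Fintype.sum_equiv (Equiv.mulLeft τ) _ _ fun σ => rfl

/-- The unit `1 ∈ 𝕋^0 = ℝ`. -/
def symOne (n : ℕ) : SymTensor n 0 where
  val := ContinuousMultilinearMap.constOfIsEmpty ℝ _ 1
  property := by
    intro σ v
    simp

/-- The power `T^k ∈ 𝕋^{pk}` of `T ∈ 𝕋^p` with respect to the symmetric tensor product. -/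
def symPow {n p : ℕ} (T : SymTensor n p) : (k : ℕ) → SymTensor n (p * k)
  | 0 => symOne n
  | k + 1 => symMul (symPow T k) T

/-- The tensor power `x^r ∈ 𝕋^r` of a vector `x ∈ ℝⁿ`, where `ℝⁿ` is identified with its dual
space via the scalar product: `x^r(v₁, …, v_r) = ⟪x, v₁⟫ ⋯ ⟪x, v_r⟫`. -/
def vecPow {n : ℕ} (x : E n) (r : ℕ) : SymTensor n r where
  val := (ContinuousMultilinearMap.mkPiAlgebra ℝ (Fin r) ℝ).compContinuousLinearMap
    fun _ => innerSL ℝ x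
  property := by
    intro σ v
    simpa using Equiv.prod_comp σ fun i => ⟪x, v i⟫

/-- The metric tensor `Q(L) ∈ 𝕋²` associated with a linear subspace `L`:
`Q(L)(x, y) = ⟪p_L x, p_L y⟫`, where `p_L` is the orthogonal projection onto `L`. -/
def metricTensorOn {n : ℕ} (L : Submodule ℝ (E n)) : SymTensor n 2 where
  val :=
    { toFun := fun v => ⟪L.starProjection (v 0), L.starProjection (v 1)⟫
      map_update_add' := by
        intro _ m i x y
        fin_cases i <;> simp [inner_add_left, inner_add_right]
      map_update_smul' := by
        intro _ m i c x
        fin_cases i <;> simp [inner_smul_left, inner_smul_right]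
      cont := by
        change Continuous fun v : Fin 2 → E n =>
          ⟪L.starProjection (v 0), L.starProjection (v 1)⟫
        fun_prop }
  property := by
    intro σ v
    change ⟪L.starProjection (v (σ 0)), L.starProjection (v (σ 1))⟫ =
      ⟪L.starProjection (v 0), L.starProjection (v 1)⟫
    have h : (σ 0 = 0 ∧ σ 1 = 1) ∨ (σ 0 = 1 ∧ σ 1 = 0) := by
      revert σ
      decide
    rcases h with ⟨h0, h1⟩ | ⟨h0, h1⟩
    · rw [h0, h1]
    · rw [h0, h1, real_inner_comm]

/-- The metric tensor `Q ∈ 𝕋²`, `Q(x, y) = ⟪x, y⟫`. -/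
def metricTensor (n : ℕ) : SymTensor n 2 where
  val :=
    { toFun := fun v => ⟪v 0, v 1⟫
      map_update_add' := by
        intro _ m i x y
        fin_cases i <;> simp [inner_add_left, inner_add_right]
      map_update_smul' := by
        intro _ m i c x
        fin_cases i <;> simp [inner_smul_left, inner_smul_right]
      cont := by
        change Continuous fun v : Fin 2 → E n => ⟪v 0, v 1⟫
        fun_prop }
  property := by
    intro σ v
    change ⟪v (σ 0), v (σ 1)⟫ = ⟪v 0, v 1⟫
    have h : (σ 0 = 0 ∧ σ 1 = 1) ∨ (σ 0 = 1 ∧ σ 1 = 0) := by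
      revert σ
      decide
    rcases h with ⟨h0, h1⟩ | ⟨h0, h1⟩
    · rw [h0, h1]
    · rw [h0, h1, real_inner_comm]

/-! ### Polytopes, faces and normal cones -/

/-- `𝒫ⁿ`: the (nonempty, convex) polytopes in `ℝⁿ`. -/
def Polytope (n : ℕ) : Type :=
  {P : Set (E n) // ∃ t : Finset (E n), t.Nonempty ∧ P = convexHull ℝ (t : Set (E n))}

/-- `ℱ_j(P)`: the set of the `j`-dimensional faces of the convex set `P`, where a face of `P` is a
convex extreme subset of `P` and its dimension is that of its affine hull. -/
def faces {n : ℕ} (P : Set (E n)) (j : ℕ) : Set (Set (E n)) :=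
  {F | F.Nonempty ∧ Convex ℝ F ∧ IsExtreme ℝ P F ∧
    Module.finrank ℝ (affineSpan ℝ F).direction = j}

/-- A polytope has only finitely many faces, so that sums over them are finite sums. -/
theorem faces_finite {n : ℕ} (P : Polytope n) (j : ℕ) : (faces P.1 j).Finite := by
  obtain ⟨P, t, -, rfl⟩ := P
  change (faces (convexHull ℝ (t : Set (E n))) j).Finite
  refine Set.Finite.subset (Set.Finite.image (fun s : Set (E n) => convexHull ℝ s)
    t.finite_toSet.powerset) ?_
  rintro F ⟨-, hconv, hext, -⟩
  refine ⟨(t : Set (E n)) ∩ F, Set.inter_subset_left, ?_⟩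
  apply Set.Subset.antisymm
  · exact convexHull_min Set.inter_subset_right hconv
  · intro x hx
    have hxP := hext.subset hx
    rw [Finset.mem_convexHull'] at hxP
    obtain ⟨w, hw0, hw1, hwx⟩ := hxP
    have key : ∀ y ∈ t, w y ≠ 0 → y ∈ F := by
      intro y hy hwy
      have hpos : 0 < w y := lt_of_le_of_ne (hw0 y hy) (Ne.symm hwy)
      have hyP : y ∈ convexHull ℝ (t : Set (E n)) := subset_convexHull ℝ _ hy
      classical
      have hs1 : ∑ z ∈ t.erase y, w z = 1 - w y := by
        rw [← hw1, ← Finset.add_sum_erase t w hy]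
        ring
      have hsx : ∑ z ∈ t.erase y, w z • z = x - w y • y := by
        rw [← hwx, ← Finset.add_sum_erase t (fun z => w z • z) hy]
        simp
      have hle : w y ≤ 1 := hw1 ▸ Finset.single_le_sum hw0 hy
      rcases hle.lt_or_eq with hlt | heq
      · have h1 : 0 < 1 - w y := by linarith
        have hzP : (1 - w y)⁻¹ • (x - w y • y) ∈ convexHull ℝ (t : Set (E n)) := by
          rw [← hsx, ← hs1, Finset.smul_sum]
          simp_rw [smul_smul]
          refine (convex_convexHull ℝ _).sum_mem ?_ ?_ ?_
          · intro i hi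
            exact mul_nonneg (inv_nonneg.2 (hs1 ▸ h1.le)) (hw0 i (Finset.mem_of_mem_erase hi))
          · rw [← Finset.mul_sum, inv_mul_cancel₀ (hs1 ▸ h1.ne')]
          · intro i hi
            exact subset_convexHull ℝ _ (Finset.mem_of_mem_erase hi)
        refine hext.left_mem_of_mem_openSegment hyP hzP hx
          ⟨w y, 1 - w y, hpos, h1, by ring, ?_⟩
        rw [smul_smul, mul_inv_cancel₀ h1.ne', one_smul]
        abel
      · have h0 : ∀ z ∈ t.erase y, w z = 0 := by
          refine (Finset.sum_eq_zero_iff_of_nonneg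
            fun z hz => hw0 z (Finset.mem_of_mem_erase hz)).1 ?_
          rw [hs1, heq]
          ring
        have : x - w y • y = 0 := by
          rw [← hsx]
          exact Finset.sum_eq_zero fun z hz => by rw [h0 z hz, zero_smul]
        rw [heq, one_smul, sub_eq_zero] at this
        exact this ▸ hx
    classical
    have hx' : x = ∑ y ∈ t.filter (fun y => w y ≠ 0), w y • y := by
      rw [← hwx]
      refine (Finset.sum_filter_of_ne ?_).symm
      intro y _ hy h0
      exact hy (by rw [h0, zero_smul])
    rw [hx']
    refine (convex_convexHull ℝ _).sum_mem ?_ ?_ ?_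
    · intro y hy
      exact hw0 y (Finset.mem_filter.1 hy).1
    · rw [← hw1]
      exact Finset.sum_filter_of_ne fun y _ hy => hy
    · intro y hy
      obtain ⟨hy1, hy2⟩ := Finset.mem_filter.1 hy
      exact subset_convexHull ℝ _ ⟨hy1, key y hy1 hy2⟩

/-- `N(P, F)`: the normal cone of `P` at its face `F`, that is, the set of all `u` such that
`⟪u, ·⟫` attains its maximum over `P` at all points of `F` (equivalently, at some point of the
relative interior of `F`). -/
def normalCone {n : ℕ} (P F : Set (E n)) : Set (E n) :=
  {u | ∀ x ∈ F, ∀ y ∈ P, ⟪u, y⟫ ≤ ⟪u, x⟫}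

/-! ### Generalized tensorial curvature measures -/

/-- `ω_k = 2 π^{k/2} / Γ(k/2)`, the `(k-1)`-dimensional volume of the unit sphere of `ℝ^k`
(for `k ≥ 1`). -/
def sphereVol (k : ℕ) : ℝ := 2 * Real.pi ^ ((k : ℝ) / 2) / Real.Gamma ((k : ℝ) / 2)

/-- The normalizing constants `c_{n,j}^{r,s,l}` for `0 ≤ j ≤ n - 1`. -/
def normConst (n j r s l : ℕ) : ℝ :=
  if j = 0 then
    if l = 0 then 1 / ((r ! : ℝ) * (s ! : ℝ)) * (sphereVol n / sphereVol (n + s)) else 1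
  else
    1 / ((r ! : ℝ) * (s ! : ℝ)) * (sphereVol (n - j) / sphereVol (n - j + s)) *
      (sphereVol (j + 2 * l) / sphereVol j)

/-- `φ_j^{r,s,l}(P, β)` for `0 ≤ j ≤ n - 1`:
`c_{n,j}^{r,s,l} ω_{n-j}⁻¹ ∑_{F ∈ ℱ_j(P)} Q(F)^l ∫_{F ∩ β} x^r ℋ^j(dx)
∫_{N(P,F) ∩ 𝕊^{n-1}} u^s ℋ^{n-j-1}(du)`. Here `μHE[d]` is the `d`-dimensional Hausdorff measure,
normalized to agree with Lebesgue measure on `ℝ^d`. -/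
def faceMeasure {n : ℕ} (j r s l : ℕ) (P : Polytope n) (β : Set (E n)) :
    SymTensor n (2 * l + r + s) :=
  (normConst n j r s l * (1 / sphereVol (n - j))) •
    ∑ᶠ F ∈ faces P.1 j,
      symMul
        (symMul (symPow (metricTensorOn (affineSpan ℝ F).direction) l)
          (∫ x in F ∩ β, vecPow x r ∂μHE[j]))
        (∫ u in normalCone P.1 F ∩ Metric.sphere 0 1, vecPow u s ∂μHE[n - j - 1])

/-- `φ_n^{r,0,l}(P, β) = (r!)⁻¹ (ω_{n+2l} / ω_n) Q^l ∫_{P ∩ β} x^r ℋ^n(dx)`. -/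
def volMeasure {n : ℕ} (r l : ℕ) (P : Polytope n) (β : Set (E n)) : SymTensor n (2 * l + r) :=
  (1 / (r ! : ℝ) * (sphereVol (n + 2 * l) / sphereVol n)) •
    symMul (symPow (metricTensor n) l) (∫ x in P.1 ∩ β, vecPow x r ∂μHE[n])

/-- The generalized tensorial curvature measure `φ_j^{r,s,l}(P, β) ∈ 𝕋^{2l+r+s}` of a polytope
`P ⊂ ℝⁿ`; it is zero by convention if `j > n`, or if `j = n` and `s ≠ 0`. -/
def tensCurvMeasure {n : ℕ} (j r : ℕ) : (s l : ℕ) → Polytope n → Set (E n) →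
    SymTensor n (2 * l + r + s)
  | 0, l, P, β =>
    if j < n then faceMeasure j r 0 l P β else if j = n then volMeasure r l P β else 0
  | s + 1, l, P, β => if j < n then faceMeasure j r (s + 1) l P β else 0

/-- The admissible indices `(m, j, r, s, l)` of rank `p` in dimension `n`. -/
structure Index (n p : ℕ) where
  m : ℕ
  j : ℕ
  r : ℕ
  s : ℕ
  l : ℕ
  j_le : j ≤ n
  rank_eq : 2 * m + 2 * l + r + s = p
  l_eq_zero : j = 0 ∨ j + 1 = n → l = 0
  top_eq_zero : j = n → s = 0 ∧ l = 0

/-- The identification of `𝕋^p` with `𝕋^q` for `p = q`. -/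
def rankCast {n p q : ℕ} (h : p = q) (T : SymTensor n p) : SymTensor n q := h ▸ T

/-- `Q^m φ_j^{r,s,l} : 𝒫ⁿ × ℬ(ℝⁿ) → 𝕋^p`, where `2m + 2l + r + s = p`. -/
def metricTensCurv {n p : ℕ} (i : Index n p) (P : Polytope n)
    (β : {β : Set (E n) // MeasurableSet β}) : SymTensor n p :=
  rankCast (by have := i.rank_eq; omega)
    (symMul (symPow (metricTensor n) i.m) (tensCurvMeasure i.j i.r i.s i.l P β.1))

end TensorCurv

end

namespace TensorCurv

open Filter Topology

/-- Evaluation of a symmetric tensor on the diagonal, `T ↦ T(v, …, v)`. -/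
noncomputable def diag {n p : ℕ} (v : E n) : SymTensor n p →L[ℝ] ℝ :=
  (ContinuousMultilinearMap.apply ℝ (fun _ : Fin p => E n) ℝ (fun _ => v)).comp
    (SymTensor n p).subtypeL

theorem diag_apply {n p : ℕ} (v : E n) (T : SymTensor n p) : diag v T = T.1 (fun _ => v) := rfl

theorem diag_symMul {n p q : ℕ} (v : E n) (T : SymTensor n p) (U : SymTensor n q) :
    diag v (symMul T U) = diag v T * diag v U := by
  have h : (((p + q)! : ℕ) : ℝ) ≠ 0 := by positivity
  simp [diag_apply, symMul, tensorMul_apply, Fintype.card_perm, h]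

theorem diag_symPow {n p : ℕ} (v : E n) (T : SymTensor n p) (k : ℕ) :
    diag v (symPow T k) = diag v T ^ k := by
  induction k with
  | zero => simp [symPow, symOne, diag_apply]
  | succ k ih => rw [symPow, pow_succ, ← ih]; exact diag_symMul v _ _

theorem diag_vecPow {n : ℕ} (v x : E n) (r : ℕ) : diag v (vecPow x r) = ⟪x, v⟫ ^ r := by
  simp [diag_apply, vecPow]

theorem diag_metricTensor {n : ℕ} (v : E n) : diag v (metricTensor n) = ‖v‖ ^ 2 :=
  real_inner_self_eq_norm_sq v

theorem diag_metricTensorOn {n : ℕ} (v : E n) (L : Submodule ℝ (E n)) :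
    diag v (metricTensorOn L) = ‖L.starProjection v‖ ^ 2 :=
  real_inner_self_eq_norm_sq (L.starProjection v)

theorem diag_rankCast {n p q : ℕ} (h : p = q) (v : E n) (T : SymTensor n p) :
    diag v (rankCast h T) = diag v T := by
  subst h; rfl

theorem continuous_vecPow {n : ℕ} (r : ℕ) : Continuous fun x : E n => vecPow x r := by
  refine Continuous.subtype_mk ?_ _
  have h : Continuous fun x : E n => fun _ : Fin r => innerSL ℝ x :=
    continuous_pi fun _ => (innerSL ℝ).continuous
  exact ((ContinuousMultilinearMap.compContinuousLinearMapContinuousMultilinear ℝ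
    (fun _ : Fin r => E n) (fun _ : Fin r => ℝ) ℝ).cont.comp h).clm_apply continuous_const

/-- Monomials in four variables with distinct exponents are linearly independent on boxes. -/
theorem coeff_eq_zero_of_sum_monomial_eq_zero {ι : Type*} (t : Finset ι) (e : ι → Fin 4 →₀ ℕ)
    (he : Set.InjOn e t) (c : ι → ℝ) (S : Fin 4 → Set ℝ) (hS : ∀ k, (S k).Infinite)
    (h : ∀ x : Fin 4 → ℝ, (∀ k, x k ∈ S k) → ∑ i ∈ t, c i * ∏ k, x k ^ e i k = 0) :
    ∀ i ∈ t, c i = 0 := by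
  classical
  intro i hi
  have h0 : ∑ i ∈ t, MvPolynomial.monomial (e i) (c i) = 0 := by
    refine MvPolynomial.funext_set S hS fun x hx => ?_
    rw [map_sum, map_zero, ← h x fun k => hx k (Set.mem_univ k)]
    refine Finset.sum_congr rfl fun i _ => ?_
    rw [MvPolynomial.eval_monomial, Finsupp.prod_fintype _ _ (by simp)]
  have h1 := congrArg (MvPolynomial.coeff (e i)) h0
  rw [MvPolynomial.coeff_sum, Finset.sum_eq_single i, MvPolynomial.coeff_monomial, if_pos rfl] at h1
  · simpa using h1
  · intro k hk hki
    rw [MvPolynomial.coeff_monomial, if_neg fun hh => hki (he hk hi hh)]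
  · exact fun hh => absurd hi hh

/-- Averages of a continuous function over sets shrinking to a point converge to its value. -/
theorem tendsto_average_of_shrinking {X V : Type*} [PseudoMetricSpace X]
    [MeasurableSpace X] [BorelSpace X] [NormedAddCommGroup V] [NormedSpace ℝ V] [CompleteSpace V]
    [SecondCountableTopology X]
    (μ : ℕ → Measure X) (s : ℕ → Set X) (hs : ∀ k, MeasurableSet (s k)) (x : X) (ε : ℕ → ℝ)
    (hε : Tendsto ε atTop (𝓝 0)) (hsx : ∀ k, s k ⊆ Metric.closedBall x (ε k))
    (h0 : ∀ k, μ k (s k) ≠ 0) (htop : ∀ k, μ k (s k) ≠ ⊤) (f : X → V) (hf : Continuous f) :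
    Tendsto (fun k => ((μ k (s k)).toReal)⁻¹ • ∫ z in s k, f z ∂μ k) atTop (𝓝 (f x)) := by
  rw [Metric.tendsto_atTop]
  intro η hη
  obtain ⟨δ, hδ, hd⟩ := Metric.continuous_iff.1 hf x (η / 2) (half_pos hη)
  obtain ⟨K, hK⟩ := (Metric.tendsto_atTop.1 hε) δ hδ
  refine ⟨K, fun k hk => ?_⟩
  have hpos : 0 < (μ k (s k)).toReal := ENNReal.toReal_pos (h0 k) (htop k)
  have hclose : ∀ z ∈ s k, ‖f z - f x‖ ≤ η / 2 := by
    intro z hz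
    rw [← dist_eq_norm]
    refine (hd z ?_).le
    have h1 := hK k hk
    rw [Real.dist_0_eq_abs] at h1
    exact lt_of_le_of_lt (hsx k hz) (lt_of_le_of_lt (le_abs_self _) h1)
  have hint : IntegrableOn f (s k) (μ k) := by
    have : IsFiniteMeasure ((μ k).restrict (s k)) := ⟨by simpa using (htop k).lt_top⟩
    refine Integrable.of_bound (C := η / 2 + ‖f x‖) ?_ ?_
    · exact hf.aestronglyMeasurable
    · refine (ae_restrict_iff' (hs k)).2 (Eventually.of_forall fun z hz => ?_)
      have := norm_le_norm_sub_add (f z) (f x)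
      linarith [hclose z hz]
  have hconst : IntegrableOn (fun _ => f x) (s k) (μ k) :=
    integrableOn_const (htop k)
  have key : ((μ k (s k)).toReal)⁻¹ • ∫ z in s k, f z ∂μ k - f x
      = ((μ k (s k)).toReal)⁻¹ • ∫ z in s k, (f z - f x) ∂μ k := by
    rw [integral_sub hint hconst, setIntegral_const, smul_sub, Measure.real,
      smul_smul, inv_mul_cancel₀ hpos.ne', one_smul]
  rw [dist_eq_norm, key, norm_smul, norm_inv, Real.norm_of_nonneg hpos.le]
  have := norm_setIntegral_le_of_norm_le_const (htop k).lt_top hclose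
  calc _ ≤ ((μ k (s k)).toReal)⁻¹ * (η / 2 * (μ k (s k)).toReal) := by
        gcongr; exact this
    _ = η / 2 := by field_simp
    _ < η := half_lt_self hη

theorem sphereVol_ne_zero {k : ℕ} (hk : 0 < k) : sphereVol k ≠ 0 := by
  have h : 0 < ((k : ℝ) / 2) := by positivity
  have := Real.Gamma_pos_of_pos h
  have := Real.pi_pos
  unfold sphereVol
  positivity

theorem normConst_ne_zero {n j : ℕ} (hj : j < n) (r s l : ℕ) : normConst n j r s l ≠ 0 := by
  have h1 := sphereVol_ne_zero (k := n) (by omega)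
  have h2 := sphereVol_ne_zero (k := n + s) (by omega)
  have h3 := sphereVol_ne_zero (k := n - j) (by omega)
  have h4 := sphereVol_ne_zero (k := n - j + s) (by omega)
  have hr : (r ! : ℝ) ≠ 0 := by positivity
  have hs : (s ! : ℝ) ≠ 0 := by positivity
  unfold normConst
  split_ifs with h0 hl
  · positivity
  · exact one_ne_zero
  · have h5 := sphereVol_ne_zero (k := j + 2 * l) (by omega)
    have h6 := sphereVol_ne_zero (k := j) (by omega)
    positivity

/-- `x` lies in the relative interior of `F`. -/
def IsRelInterior {n : ℕ} (F : Set (E n)) (x : E n) : Prop :=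
  x ∈ F ∧ ∀ d ∈ (affineSpan ℝ F).direction, ∃ t : ℝ, 0 < t ∧ x + t • d ∈ F

theorem subset_of_isExtreme_of_mem {n : ℕ} {P F G : Set (E n)} {x : E n} (hG : IsExtreme ℝ P G)
    (hFP : F ⊆ P) (hx : IsRelInterior F x) (hxG : x ∈ G) : F ⊆ G := by
  intro z hz
  have hd : x - z ∈ (affineSpan ℝ F).direction :=
    AffineSubspace.vsub_mem_direction (subset_affineSpan ℝ F hx.1) (subset_affineSpan ℝ F hz)
  obtain ⟨t, ht, hw⟩ := hx.2 _ hd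
  refine hG.left_mem_of_mem_openSegment (hFP hz) (hFP hw) hxG
    ⟨t / (1 + t), 1 / (1 + t), by positivity, by positivity, by field_simp; ring, ?_⟩
  ext i
  simp
  field_simp
  ring

theorem eq_of_subset_of_finrank_eq {n : ℕ} {P F G : Set (E n)} {x : E n} (hF : IsExtreme ℝ P F)
    (hx : IsRelInterior F x) (hGP : G ⊆ P) (hFG : F ⊆ G)
    (h : Module.finrank ℝ (affineSpan ℝ F).direction =
      Module.finrank ℝ (affineSpan ℝ G).direction) : G = F := by
  refine Set.Subset.antisymm (fun z hz => ?_) hFG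
  have hdir := Submodule.eq_of_le_of_finrank_eq
    (AffineSubspace.direction_le (affineSpan_mono ℝ hFG)) h
  have hd : x - z ∈ (affineSpan ℝ F).direction := by
    rw [hdir]
    exact AffineSubspace.vsub_mem_direction (subset_affineSpan ℝ G (hFG hx.1))
      (subset_affineSpan ℝ G hz)
  obtain ⟨t, ht, hw⟩ := hx.2 _ hd
  refine hF.left_mem_of_mem_openSegment (hGP hz) (hF.subset hw) hx.1
    ⟨t / (1 + t), 1 / (1 + t), by positivity, by positivity, by field_simp; ring, ?_⟩
  ext i
  simp
  field_simp
  ring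

/-- Near the relative interior of a `j`-face, only that face carries mass. -/
theorem inter_null_of_mem_faces {n j k : ℕ} {P F G β : Set (E n)} (hF : F ∈ faces P j)
    (hβ : ∀ x ∈ β, IsRelInterior F x) (htop : μHE[j] β ≠ ⊤) (hG : G ∈ faces P k)
    (hne : k = j → G ≠ F) : μHE[k] (G ∩ β) = 0 := by
  obtain ⟨-, -, hFe, hFd⟩ := hF
  obtain ⟨-, -, hGe, hGd⟩ := hG
  rcases (G ∩ β).eq_empty_or_nonempty with he | ⟨x, hxG, hxβ⟩
  · rw [he, measure_empty]
  have hFG := subset_of_isExtreme_of_mem hGe hFe.subset (hβ x hxβ) hxG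
  have hle : j ≤ k := by
    rw [← hFd, ← hGd]
    exact Submodule.finrank_mono (AffineSubspace.direction_le (affineSpan_mono ℝ hFG))
  rcases hle.lt_or_eq with hlt | heq
  · refine measure_mono_null Set.inter_subset_right ?_
    exact (Measure.euclideanHausdorffMeasure_zero_or_top hlt β).resolve_right htop
  · exact absurd (eq_of_subset_of_finrank_eq hFe (hβ x hxβ) hGe.subset hFG (by omega))
      (hne heq.symm)

theorem diag_faceMeasure_of_ne {n j k r s l : ℕ} {P : Polytope n} {F β : Set (E n)}
    (hF : F ∈ faces P.1 j) (hβ : ∀ x ∈ β, IsRelInterior F x) (htop : μHE[j] β ≠ ⊤)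
    (hk : k ≠ j) (v : E n) : diag v (faceMeasure k r s l P β) = 0 := by
  have h : ∀ G ∈ faces P.1 k, diag v (symMul
        (symMul (symPow (metricTensorOn (affineSpan ℝ G).direction) l)
          (∫ x in G ∩ β, vecPow x r ∂μHE[k]))
        (∫ u in normalCone P.1 G ∩ Metric.sphere 0 1, vecPow u s ∂μHE[n - k - 1])) = 0 := by
    intro G hG
    rw [diag_symMul, diag_symMul, setIntegral_measure_zero _
      (inter_null_of_mem_faces hF hβ htop hG fun h => absurd h hk)]
    simp
  rw [faceMeasure, map_smul, finsum_mem_eq_finite_toFinset_sum _ (faces_finite P k), map_sum,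
    Finset.sum_eq_zero, smul_zero]
  intro G hG
  exact h G ((faces_finite P k).mem_toFinset.1 hG)

theorem diag_faceMeasure_self {n j r s l : ℕ} {P : Polytope n} {F β : Set (E n)}
    (hF : F ∈ faces P.1 j) (hβ : ∀ x ∈ β, IsRelInterior F x) (htop : μHE[j] β ≠ ⊤) (v : E n) :
    diag v (faceMeasure j r s l P β) = (normConst n j r s l * (1 / sphereVol (n - j))) *
      ((‖(affineSpan ℝ F).direction.starProjection v‖ ^ 2) ^ l *
        diag v (∫ x in β, vecPow x r ∂μHE[j]) *
        diag v (∫ u in normalCone P.1 F ∩ Metric.sphere 0 1, vecPow u s ∂μHE[n - j - 1])) := by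
  have hFβ : F ∩ β = β := Set.inter_eq_right.2 fun x hx => (hβ x hx).1
  rw [faceMeasure, map_smul, finsum_mem_eq_finite_toFinset_sum _ (faces_finite P j), map_sum,
    Finset.sum_eq_single F, diag_symMul, diag_symMul, diag_symPow, diag_metricTensorOn, hFβ,
    smul_eq_mul]
  · intro G hG hne
    rw [diag_symMul, diag_symMul, setIntegral_measure_zero _
      (inter_null_of_mem_faces hF hβ htop ((faces_finite P j).mem_toFinset.1 hG) fun _ => hne)]
    simp
  · exact fun h => absurd ((faces_finite P j).mem_toFinset.2 hF) h

/-- The coordinate subspace spanned by the standard basis vectors with index in `s`. -/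
def coordSub {n : ℕ} (s : Finset (Fin n)) : Submodule ℝ (E n) where
  carrier := {x | ∀ i, i ∉ s → x i = 0}
  add_mem' := by
    intro a b ha hb i hi
    simp [ha i hi, hb i hi]
  zero_mem' := by
    intro i _
    simp
  smul_mem' := by
    intro c a ha i hi
    simp [ha i hi]

theorem mem_coordSub {n : ℕ} {s : Finset (Fin n)} {x : E n} :
    x ∈ coordSub s ↔ ∀ i, i ∉ s → x i = 0 := Iff.rfl

theorem finrank_coordSub {n : ℕ} (s : Finset (Fin n)) :
    Module.finrank ℝ (coordSub s) = s.card := by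
  let e : coordSub s ≃ₗ[ℝ] (s → ℝ) :=
    { toFun := fun x i => x.1 i
      map_add' := fun _ _ => rfl
      map_smul' := fun _ _ => rfl
      invFun := fun z => ⟨WithLp.toLp 2 fun i => if h : i ∈ s then z ⟨i, h⟩ else 0, by
        intro i hi
        simp [hi]⟩
      left_inv := by
        intro x
        ext i
        by_cases hi : i ∈ s
        · simp [hi]
        · simp [hi, x.2 i hi]
      right_inv := by
        intro z
        ext i
        simp }
  simp [e.finrank_eq]

theorem starProjection_coordSub {n : ℕ} (s : Finset (Fin n)) (v : E n) :
    (coordSub s).starProjection v = WithLp.toLp 2 fun i => if i ∈ s then v i else 0 := by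
  refine Submodule.eq_starProjection_of_mem_of_inner_eq_zero ?_ ?_
  · intro i hi
    simp [hi]
  · intro w hw
    rw [PiLp.inner_apply]
    refine Finset.sum_eq_zero fun i _ => ?_
    by_cases hi : i ∈ s
    · simp [hi]
    · simp [hw i hi]

theorem inner_single_right {n : ℕ} (u : E n) (i : Fin n) (a : ℝ) :
    ⟪u, EuclideanSpace.single i a⟫ = a * u i := by
  rw [EuclideanSpace.inner_single_right]
  rfl

theorem inner_single_left {n : ℕ} (u : E n) (i : Fin n) (a : ℝ) :
    ⟪EuclideanSpace.single i a, u⟫ = a * u i := by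
  rw [real_inner_comm, inner_single_right]

/-- A convex set containing `0` and `± eᵢ` for `i ∈ s` contains a ball of `coordSub s`. -/
theorem mem_of_convex_of_coordSub {n : ℕ} (hn : 0 < n) {s : Finset (Fin n)} {C : Set (E n)}
    (hC : Convex ℝ C) (h0 : (0 : E n) ∈ C)
    (h1 : ∀ i ∈ s, EuclideanSpace.single i (1 : ℝ) ∈ C)
    (h2 : ∀ i ∈ s, -EuclideanSpace.single i (1 : ℝ) ∈ C) {x : E n} (hx : x ∈ coordSub s)
    (hxn : ‖x‖ ≤ 1 / n) : x ∈ C := by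
  have hn' : (0 : ℝ) < n := by exact_mod_cast hn
  have hsum : x = ∑ i : Fin n, (1 / n : ℝ) • ((n * x i) • EuclideanSpace.single i (1 : ℝ)) := by
    ext k
    simp only [WithLp.ofLp_sum, Finset.sum_apply, PiLp.smul_apply, smul_eq_mul, PiLp.single_apply]
    rw [Finset.sum_eq_single k (fun i _ hi => by simp [hi.symm]) (by simp)]
    simp [hn'.ne']
  rw [hsum]
  refine hC.sum_mem (fun _ _ => by positivity) (by simp [hn'.ne']) fun i _ => ?_
  by_cases hi : i ∈ s
  · have hb : |n * x i| ≤ 1 := by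
      have : |x i| ≤ ‖x‖ := PiLp.norm_apply_le x i
      rw [abs_mul, abs_of_pos hn']
      calc n * |x i| ≤ n * (1 / n) := by gcongr; exact this.trans hxn
        _ = 1 := by field_simp
    obtain ⟨hb1, hb2⟩ := abs_le.1 hb
    have := hC (h1 i hi) (h2 i hi) (a := (1 + n * x i) / 2) (b := (1 - n * x i) / 2)
      (by linarith) (by linarith) (by ring)
    convert this using 1
    rw [smul_neg, ← sub_eq_add_neg, ← sub_smul]
    congr 1
    ring
  · rw [hx i hi, mul_zero, zero_smul]
    exact h0

section Flat

variable {n : ℕ} {F : Set (E n)} {L : Submodule ℝ (E n)} {y : E n} {ρ : ℝ}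

theorem direction_eq_of_ball_subset (hρ : 0 < ρ) (hFL : ∀ x ∈ F, x - y ∈ L)
    (hLF : ∀ w ∈ L, ‖w‖ ≤ ρ → y + w ∈ F) : (affineSpan ℝ F).direction = L := by
  rw [direction_affineSpan]
  refine le_antisymm ?_ fun w hw => ?_
  · rw [vectorSpan_def, Submodule.span_le]
    rintro _ ⟨a, ha, b, hb, rfl⟩
    have := L.sub_mem (hFL a ha) (hFL b hb)
    simpa using this
  · have hy : y ∈ F := by simpa using hLF 0 L.zero_mem (by simpa using hρ.le)
    have hpos : 0 < ρ / (‖w‖ + 1) := by positivity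
    have hmem : y + (ρ / (‖w‖ + 1)) • w ∈ F := by
      refine hLF _ (L.smul_mem _ hw) ?_
      rw [norm_smul, Real.norm_of_nonneg hpos.le, div_mul_eq_mul_div, div_le_iff₀ (by positivity)]
      nlinarith [norm_nonneg w]
    have := Submodule.smul_mem _ (ρ / (‖w‖ + 1))⁻¹ (vsub_mem_vectorSpan ℝ hmem hy)
    rwa [vsub_eq_sub, add_sub_cancel_left, smul_smul, inv_mul_cancel₀ hpos.ne', one_smul] at this

theorem isRelInterior_of_ball_subset (hρ : 0 < ρ) (hFL : ∀ x ∈ F, x - y ∈ L)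
    (hLF : ∀ w ∈ L, ‖w‖ ≤ ρ → y + w ∈ F) {w : E n} (hw : w ∈ L) (hwρ : ‖w‖ ≤ ρ / 2) :
    IsRelInterior F (y + w) := by
  refine ⟨hLF w hw (by linarith), fun d hd => ?_⟩
  rw [direction_eq_of_ball_subset hρ hFL hLF] at hd
  have hpos : 0 < ρ / 2 / (‖d‖ + 1) := by positivity
  refine ⟨_, hpos, ?_⟩
  rw [add_assoc]
  refine hLF _ (L.add_mem hw (L.smul_mem _ hd)) ?_
  have h1 : ‖(ρ / 2 / (‖d‖ + 1)) • d‖ ≤ ρ / 2 := by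
    rw [norm_smul, Real.norm_of_nonneg hpos.le, div_mul_eq_mul_div, div_le_iff₀ (by positivity)]
    nlinarith [norm_nonneg d]
  linarith [norm_add_le w ((ρ / 2 / (‖d‖ + 1)) • d)]

end Flat

/-- The closed ball of radius `ε` around `y` in the flat `y + L`. -/
def flatBall {n : ℕ} (L : Submodule ℝ (E n)) (y : E n) (ε : ℝ) : Set (E n) :=
  (fun w : L => y + (w : E n)) '' Metric.closedBall 0 ε

section FlatBall

variable {n : ℕ} (L : Submodule ℝ (E n)) (y : E n) (ε : ℝ)

theorem isometry_flat : Isometry fun w : L => y + (w : E n) :=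
  (IsometryEquiv.addLeft y).isometry.comp L.subtypeₗᵢ.isometry

theorem isCompact_flatBall : IsCompact (flatBall L y ε) :=
  (isCompact_closedBall 0 ε).image (isometry_flat L y).continuous

theorem flatBall_subset : flatBall L y ε ⊆ Metric.closedBall y ε := by
  rintro _ ⟨w, hw, rfl⟩
  simpa using hw

theorem hausdorff_flatBall_ne_zero {j : ℕ} (hL : Module.finrank ℝ L = j) (hε : 0 < ε) :
    μHE[j] (flatBall L y ε) ≠ 0 := by
  subst hL
  rw [flatBall, (isometry_flat L y).euclideanHausdorffMeasure_image]
  exact (Metric.measure_closedBall_pos _ _ hε).ne'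

theorem hausdorff_flatBall_ne_top {j : ℕ} (hL : Module.finrank ℝ L = j) :
    μHE[j] (flatBall L y ε) ≠ ⊤ := by
  subst hL
  rw [flatBall, (isometry_flat L y).euclideanHausdorffMeasure_image]
  exact measure_closedBall_lt_top.ne

end FlatBall

/-- A cone around the `j`-th coordinate direction in the orthogonal complement of the span of the
preceding basis vectors. -/
def coordCone {n : ℕ} (j : Fin n) (δ : ℝ) : Set (E n) :=
  {u | (∀ i < j, u i = 0) ∧ 0 ≤ u j ∧ ∀ k > j, |u k| ≤ δ * u j}

open Classical in
/-- The vertices of a polytope with normal cone `coordCone j δ` at a `j`-face through `0`. -/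
noncomputable def conePts {n : ℕ} (j : Fin n) (δ : ℝ) : Finset (E n) :=
  {0} ∪ (Finset.Iio j).image (fun i => EuclideanSpace.single i (1 : ℝ)) ∪
    (Finset.Iio j).image (fun i => -EuclideanSpace.single i (1 : ℝ)) ∪
    {-EuclideanSpace.single j (1 : ℝ)} ∪
    (Finset.Ioi j).image (fun k =>
      -EuclideanSpace.single j δ + EuclideanSpace.single k (1 : ℝ)) ∪
    (Finset.Ioi j).image (fun k =>
      -EuclideanSpace.single j δ - EuclideanSpace.single k (1 : ℝ))

theorem mem_conePts {n : ℕ} {j : Fin n} {δ : ℝ} {g : E n} :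
    g ∈ conePts j δ ↔ g = 0 ∨ (∃ i < j, g = EuclideanSpace.single i (1 : ℝ)) ∨
      (∃ i < j, g = -EuclideanSpace.single i (1 : ℝ)) ∨ g = -EuclideanSpace.single j (1 : ℝ) ∨
      (∃ k > j, g = -EuclideanSpace.single j δ + EuclideanSpace.single k (1 : ℝ)) ∨
      ∃ k > j, g = -EuclideanSpace.single j δ - EuclideanSpace.single k (1 : ℝ) := by
  simp only [conePts, Finset.mem_union, Finset.mem_image, Finset.mem_singleton,
    Finset.mem_Iio, Finset.mem_Ioi, or_assoc, eq_comm (b := g)]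

theorem zero_mem_conePts {n : ℕ} (j : Fin n) (δ : ℝ) : 0 ∈ conePts j δ :=
  mem_conePts.2 (Or.inl rfl)

theorem single_mem_conePts {n : ℕ} {i j : Fin n} (h : i < j) (δ : ℝ) :
    EuclideanSpace.single i (1 : ℝ) ∈ conePts j δ :=
  mem_conePts.2 (Or.inr (Or.inl ⟨i, h, rfl⟩))

theorem neg_single_mem_conePts {n : ℕ} {i j : Fin n} (h : i ≤ j) (δ : ℝ) :
    -EuclideanSpace.single i (1 : ℝ) ∈ conePts j δ := by
  rcases h.lt_or_eq with h | rfl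
  · exact mem_conePts.2 (Or.inr (Or.inr (Or.inl ⟨i, h, rfl⟩)))
  · exact mem_conePts.2 (Or.inr (Or.inr (Or.inr (Or.inl rfl))))

theorem mem_coordCone_iff {n : ℕ} (j : Fin n) (δ : ℝ) (u : E n) :
    u ∈ coordCone j δ ↔ ∀ g ∈ conePts j δ, ⟪u, g⟫ ≤ 0 := by
  constructor
  · rintro ⟨h1, h2, h3⟩ g hg
    rcases mem_conePts.1 hg with rfl | ⟨i, hi, rfl⟩ | ⟨i, hi, rfl⟩ | rfl | ⟨k, hk, rfl⟩ |
      ⟨k, hk, rfl⟩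
    · rw [inner_zero_right]
    · rw [inner_single_right, h1 i hi, mul_zero]
    · rw [inner_neg_right, inner_single_right, h1 i hi, mul_zero, neg_zero]
    · rw [inner_neg_right, inner_single_right]
      linarith
    · have := (abs_le.1 (h3 k hk)).2
      rw [inner_add_right, inner_neg_right, inner_single_right, inner_single_right]
      linarith
    · have := (abs_le.1 (h3 k hk)).1
      rw [inner_sub_right, inner_neg_right, inner_single_right, inner_single_right]
      linarith
  · intro h
    refine ⟨fun i hi => ?_, ?_, fun k hk => abs_le.2 ⟨?_, ?_⟩⟩
    · have h1 := h _ (single_mem_conePts hi δ)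
      have h2 := h _ (neg_single_mem_conePts hi.le δ)
      rw [inner_neg_right, inner_single_right] at h2
      rw [inner_single_right] at h1
      linarith
    · have h1 := h _ (neg_single_mem_conePts le_rfl δ)
      rw [inner_neg_right, inner_single_right] at h1
      linarith
    · have h1 := h (-EuclideanSpace.single j δ - EuclideanSpace.single k 1)
        (mem_conePts.2 (Or.inr (Or.inr (Or.inr (Or.inr (Or.inr ⟨k, hk, rfl⟩))))))
      rw [inner_sub_right, inner_neg_right, inner_single_right, inner_single_right] at h1
      linarith
    · have h1 := h (-EuclideanSpace.single j δ + EuclideanSpace.single k 1)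
        (mem_conePts.2 (Or.inr (Or.inr (Or.inr (Or.inr (Or.inl ⟨k, hk, rfl⟩))))))
      rw [inner_add_right, inner_neg_right, inner_single_right, inner_single_right] at h1
      linarith

/-- The polytope `y + conv t`. -/
def hullAt {n : ℕ} (y : E n) (t : Finset (E n)) (ht : t.Nonempty) : Polytope n :=
  ⟨convexHull ℝ ((fun g => y + g) '' (t : Set (E n))), by
    classical
    exact ⟨t.image fun g => y + g, ht.image _, by rw [Finset.coe_image]⟩⟩

theorem conePts_nonempty {n : ℕ} (j : Fin n) (δ : ℝ) : (conePts j δ).Nonempty :=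
  ⟨0, zero_mem_conePts j δ⟩

theorem add_mem_hullAt {n : ℕ} (y : E n) {t : Finset (E n)} (ht : t.Nonempty) {g : E n}
    (hg : g ∈ t) : y + g ∈ (hullAt y t ht).1 :=
  subset_convexHull ℝ _ ⟨g, hg, rfl⟩

theorem inner_sub_le_of_mem_hullAt {n : ℕ} {y u x : E n} {t : Finset (E n)} {ht : t.Nonempty}
    (hu : ∀ g ∈ t, ⟪u, g⟫ ≤ 0) (hx : x ∈ (hullAt y t ht).1) : ⟪u, x - y⟫ ≤ 0 := by
  have hc : Convex ℝ {x : E n | ⟪u, x⟫ ≤ ⟪u, y⟫} :=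
    convex_halfSpace_le (innerSL ℝ u).toLinearMap.isLinear _
  have := convexHull_min (t := {x : E n | ⟪u, x⟫ ≤ ⟪u, y⟫}) ?_ hc hx
  · rw [inner_sub_right]
    exact sub_nonpos.2 this
  · rintro _ ⟨g, hg, rfl⟩
    have := hu g hg
    simp only [Set.mem_ofPred_eq, inner_add_right]
    linarith

section ConeFace

variable {n : ℕ} (y : E n) (j : Fin n) (δ : ℝ)

/-- The polytope `y + conv (conePts j δ)`. -/
noncomputable def conePolytope : Polytope n := hullAt y (conePts j δ) (conePts_nonempty j δ)

/-- The `j`-face of `conePolytope y j δ` through `y`. -/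
def coneFace : Set (E n) := {x ∈ (conePolytope y j δ).1 | x j = y j}

theorem self_mem_coneFace : y ∈ coneFace y j δ := by
  refine ⟨?_, rfl⟩
  have := add_mem_hullAt y (conePts_nonempty j δ) (zero_mem_conePts j δ)
  rwa [add_zero] at this

variable {δ}

theorem le_of_mem_conePolytope (hδ : 0 < δ) {x : E n} (hx : x ∈ (conePolytope y j δ).1) :
    x j ≤ y j := by
  have h : EuclideanSpace.single j (1 : ℝ) ∈ coordCone j δ := by
    refine ⟨fun i hi => by simp [hi.ne], by simp, fun k hk => by simp [hk.ne', hδ.le]⟩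
  have := inner_sub_le_of_mem_hullAt ((mem_coordCone_iff j δ _).1 h) hx
  rw [inner_single_left] at this
  simpa using this

theorem coneFace_sub_mem (hδ : 0 < δ) {x : E n} (hx : x ∈ coneFace y j δ) :
    x - y ∈ coordSub (Finset.Iio j) := by
  intro k hk
  rw [Finset.mem_Iio, not_lt] at hk
  rcases hk.eq_or_lt with rfl | hlt
  · simp [hx.2]
  have h (a : ℝ) (ha : |a| ≤ δ) : a * (x k - y k) ≤ 0 := by
    have h : EuclideanSpace.single j (1 : ℝ) + EuclideanSpace.single k a ∈ coordCone j δ := by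
      refine ⟨fun i hi => by simp [hi.ne, (hi.trans hlt).ne], by simp [hlt.ne], fun l hl => ?_⟩
      by_cases hlk : l = k
      · subst hlk; simp [hl.ne', hl.ne, ha]
      · simp [hl.ne', hlk, hlt.ne, hδ.le]
    have := inner_sub_le_of_mem_hullAt ((mem_coordCone_iff j δ _).1 h) hx.1
    rw [inner_add_left, inner_single_left, inner_single_left] at this
    simpa [hx.2] using this
  have h1 := h δ (abs_of_pos hδ).le
  have h2 := h (-δ) (by rw [abs_neg, abs_of_pos hδ])
  have : δ * (x k - y k) = 0 := by linarith
  simpa using (mul_eq_zero.1 this).resolve_left hδ.ne'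

theorem convex_coneFace : Convex ℝ (coneFace y j δ) :=
  (convex_convexHull ℝ _).inter
    (convex_hyperplane (EuclideanSpace.proj (𝕜 := ℝ) j).toLinearMap.isLinear (y j))

theorem add_mem_coneFace {w : E n} (hw : w ∈ coordSub (Finset.Iio j)) (hwn : ‖w‖ ≤ 1 / n) :
    y + w ∈ coneFace y j δ := by
  refine mem_of_convex_of_coordSub (C := {w | y + w ∈ coneFace y j δ}) j.pos
    (Convex.translate_preimage_right (convex_coneFace y j) y) ?_ ?_ ?_ hw hwn
  · simpa using self_mem_coneFace y j δ
  · intro i hi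
    exact ⟨add_mem_hullAt y _ (single_mem_conePts (Finset.mem_Iio.1 hi) δ), by simp [(Finset.mem_Iio.1 hi).ne']⟩
  · intro i hi
    exact ⟨add_mem_hullAt y _ (neg_single_mem_conePts (Finset.mem_Iio.1 hi).le δ), by simp [(Finset.mem_Iio.1 hi).ne']⟩

theorem direction_coneFace (hδ : 0 < δ) :
    (affineSpan ℝ (coneFace y j δ)).direction = coordSub (Finset.Iio j) := by
  have hn : 0 < n := j.pos
  exact direction_eq_of_ball_subset (ρ := 1 / n) (by positivity)
    (fun x hx => coneFace_sub_mem y j hδ hx) fun w hw h => add_mem_coneFace y j hw h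

theorem coneFace_mem_faces (hδ : 0 < δ) : coneFace y j δ ∈ faces (conePolytope y j δ).1 j := by
  refine ⟨⟨y, self_mem_coneFace y j δ⟩, convex_coneFace y j, ⟨fun x hx => hx.1, ?_⟩, ?_⟩
  · rintro a ha b hb x hx ⟨s, t, hs, ht, hst, rfl⟩
    refine ⟨ha, ?_⟩
    have h1 := le_of_mem_conePolytope y j hδ ha
    have h2 := le_of_mem_conePolytope y j hδ hb
    have h3 : s * a j + t * b j = y j := by simpa using hx.2
    refine le_antisymm h1 (le_of_mul_le_mul_left ?_ hs)
    have : t * b j ≤ t * y j := by gcongr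
    linear_combination this + y j * hst - h3
  · rw [direction_coneFace y j hδ, finrank_coordSub, Fin.card_Iio]

theorem normalCone_coneFace (hδ : 0 < δ) :
    normalCone (conePolytope y j δ).1 (coneFace y j δ) = coordCone j δ := by
  ext u
  constructor
  · intro hu
    rw [mem_coordCone_iff]
    intro g hg
    have := hu y (self_mem_coneFace y j δ) _ (add_mem_hullAt y (conePts_nonempty j δ) hg)
    rw [inner_add_right] at this
    linarith
  · intro hu x hx z hz
    have h1 := inner_sub_le_of_mem_hullAt ((mem_coordCone_iff j δ u).1 hu) hz
    have h2 : ⟪u, x - y⟫ = 0 := by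
      rw [PiLp.inner_apply]
      refine Finset.sum_eq_zero fun i _ => ?_
      by_cases hi : i < j
      · simp [hu.1 i hi]
      · have := coneFace_sub_mem y j hδ hx i (by simpa using hi)
        rw [this]; simp
    rw [inner_sub_right] at h1 h2
    linarith

end ConeFace

theorem euclideanHausdorff_ne_zero_iff {X : Type*} [EMetricSpace X] [MeasurableSpace X]
    [BorelSpace X] (d : ℕ) (s : Set X) : μHE[d] s ≠ 0 ↔ μH[d] s ≠ 0 := by
  rw [Measure.euclideanHausdorffMeasure_def, Measure.smul_apply, ENNReal.smul_def, smul_eq_mul,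
    mul_ne_zero_iff, ENNReal.coe_ne_zero]
  exact and_iff_right (Measure.addHaarScalarFactor_volume_hausdorffMeasure_ne_zero d)

theorem euclideanHausdorff_ne_top_iff {X : Type*} [EMetricSpace X] [MeasurableSpace X]
    [BorelSpace X] (d : ℕ) (s : Set X) : μHE[d] s ≠ ⊤ ↔ μH[d] s ≠ ⊤ := by
  rw [Measure.euclideanHausdorffMeasure_def, Measure.smul_apply, ENNReal.smul_def, smul_eq_mul]
  simp [ENNReal.mul_eq_top, Measure.addHaarScalarFactor_volume_hausdorffMeasure_ne_zero d]

section Graph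

variable {n : ℕ} (j : Fin n)

/-- The hemisphere around the `j`-th basis vector in the span of the basis vectors from the `j`-th
on, as a graph. -/
noncomputable def sphereGraph (w : coordSub (Finset.Ioi j)) : E n :=
  EuclideanSpace.single j (√(1 - ‖w‖ ^ 2)) + (w : E n)

theorem coordSub_Ioi_apply {k : Fin n} (hk : k ≤ j) (w : coordSub (Finset.Ioi j)) :
    (w : E n) k = 0 :=
  w.2 k (by simpa using hk)

theorem sphereGraph_self (w : coordSub (Finset.Ioi j)) :
    sphereGraph j w j = √(1 - ‖w‖ ^ 2) := by
  simp [sphereGraph, coordSub_Ioi_apply j le_rfl w]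

theorem sphereGraph_of_ne {k : Fin n} (hk : k ≠ j) (w : coordSub (Finset.Ioi j)) :
    sphereGraph j w k = (w : E n) k := by
  simp [sphereGraph, hk]

theorem norm_single_add_sq (b : ℝ) (w : coordSub (Finset.Ioi j)) :
    ‖EuclideanSpace.single j b + (w : E n)‖ ^ 2 = b ^ 2 + ‖w‖ ^ 2 := by
  rw [norm_add_sq_real, inner_single_left, coordSub_Ioi_apply j le_rfl w]
  simp

theorem norm_sphereGraph {w : coordSub (Finset.Ioi j)} (hw : ‖w‖ ≤ 1) : ‖sphereGraph j w‖ = 1 := by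
  have h := norm_single_add_sq j (√(1 - ‖w‖ ^ 2)) w
  rw [Real.sq_sqrt (by nlinarith [norm_nonneg w]), sub_add_cancel] at h
  exact (pow_eq_one_iff_of_nonneg (norm_nonneg _) two_ne_zero).1 h

theorem lipschitzOnWith_sphereGraph :
    LipschitzOnWith 2 (sphereGraph j) {w | ‖w‖ ^ 2 ≤ 1 / 2} := by
  refine LipschitzOnWith.of_dist_le_mul fun w hw w' hw' => ?_
  rw [dist_eq_norm, dist_eq_norm]
  have hle {x : coordSub (Finset.Ioi j)} (hx : ‖x‖ ^ 2 ≤ 1 / 2) : ‖x‖ ≤ √(1 - ‖x‖ ^ 2) :=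
    Real.le_sqrt_of_sq_le (by linarith)
  have hsq {x : coordSub (Finset.Ioi j)} (hx : ‖x‖ ^ 2 ≤ 1 / 2) :
      √(1 - ‖x‖ ^ 2) ^ 2 = 1 - ‖x‖ ^ 2 := Real.sq_sqrt (by linarith)
  have hpos {x : coordSub (Finset.Ioi j)} (hx : ‖x‖ ^ 2 ≤ 1 / 2) : 0 < √(1 - ‖x‖ ^ 2) :=
    Real.sqrt_pos.2 (by linarith)
  set b := √(1 - ‖w‖ ^ 2)
  set b' := √(1 - ‖w'‖ ^ 2)
  have hb := hle hw
  have hb' := hle hw'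
  have hkey : |b - b'| ≤ ‖w - w'‖ := by
    have hp : 0 < b + b' := add_pos (hpos hw) (hpos hw')
    have h1 : |b - b'| * (b + b') = |‖w'‖ - ‖w‖| * (‖w'‖ + ‖w‖) := by
      conv_lhs => rw [← abs_of_pos hp, ← abs_mul]
      conv_rhs =>
        rw [← abs_of_nonneg (add_nonneg (norm_nonneg w') (norm_nonneg w)), ← abs_mul]
      congr 1
      linear_combination hsq hw - hsq hw'
    have h2 : |‖w'‖ - ‖w‖| ≤ ‖w - w'‖ := by
      rw [abs_sub_comm]
      exact abs_norm_sub_norm_le w w'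
    refine le_of_mul_le_mul_right (h1.le.trans ?_) hp
    exact mul_le_mul h2 (by linarith) (by positivity) (by positivity)
  have heq : sphereGraph j w - sphereGraph j w' =
      EuclideanSpace.single j (b - b') + ((w - w' : coordSub (Finset.Ioi j)) : E n) := by
    ext k
    simp only [sphereGraph, PiLp.sub_apply, PiLp.add_apply, PiLp.single_apply, Submodule.coe_sub]
    split_ifs <;> ring
  rw [heq]
  refine (norm_add_le _ _).trans ?_
  rw [PiLp.norm_single, Real.norm_eq_abs, ← Submodule.coe_norm, NNReal.coe_ofNat]
  linarith

variable {δ : ℝ}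

theorem norm_sq_le_of_mem_coordCone {w : coordSub (Finset.Ioi j)} {b : ℝ}
    (h : ∀ k > j, |(w : E n) k| ≤ δ * b) : ‖w‖ ^ 2 ≤ n * (δ ^ 2 * b ^ 2) := by
  rw [Submodule.coe_norm, EuclideanSpace.norm_sq_eq]
  calc ∑ k, ‖(w : E n) k‖ ^ 2 ≤ ∑ k : Fin n, δ ^ 2 * b ^ 2 := by
        refine Finset.sum_le_sum fun k _ => ?_
        by_cases hk : j < k
        · rw [← mul_pow, Real.norm_eq_abs]
          exact pow_le_pow_left₀ (abs_nonneg _) (h k hk) 2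
        · rw [coordSub_Ioi_apply j (not_lt.1 hk) w]
          rw [norm_zero, zero_pow two_ne_zero]
          positivity
    _ = n * (δ ^ 2 * b ^ 2) := by simp

/-- The points of the spherical cone are given by the graph. -/
theorem exists_sphereGraph_eq (hδn : 2 * (n * δ ^ 2) ≤ 1) {u : E n}
    (hu : u ∈ coordCone j δ ∩ Metric.sphere 0 1) :
    ∃ w : coordSub (Finset.Ioi j), sphereGraph j w = u ∧ ‖w‖ ^ 2 ≤ n * δ ^ 2 := by
  obtain ⟨⟨h1, h2, h3⟩, hu1⟩ := hu
  let w : coordSub (Finset.Ioi j) := ⟨u - EuclideanSpace.single j (u j), by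
    intro k hk
    rw [Finset.mem_Ioi, not_lt] at hk
    rcases hk.eq_or_lt with rfl | hlt
    · simp
    · simp [hlt.ne, h1 k hlt]⟩
  have hw : EuclideanSpace.single j (u j) + (w : E n) = u := by simp [w]
  have hnorm := norm_single_add_sq j (u j) w
  rw [hw, mem_sphere_zero_iff_norm.1 hu1] at hnorm
  have hle := norm_sq_le_of_mem_coordCone j (w := w) (b := u j) (fun k hk => by
    simpa [w, hk.ne'] using h3 k hk)
  have hb : u j ^ 2 ≤ 1 := by nlinarith [sq_nonneg ‖w‖]
  refine ⟨w, ?_, hle.trans ?_⟩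
  · have : √(1 - ‖w‖ ^ 2) = u j := by
      rw [show 1 - ‖w‖ ^ 2 = u j ^ 2 by linarith, Real.sqrt_sq h2]
    rw [sphereGraph, this, hw]
  · have : (0 : ℝ) ≤ n * δ ^ 2 := by positivity
    nlinarith

theorem coordCone_subset_closedBall {ε : ℝ} (hε : 0 ≤ ε)
    (hδn : 2 * (n * δ ^ 2) ≤ 1) (hδε : 2 * (n * δ ^ 2) ≤ ε ^ 2) :
    coordCone j δ ∩ Metric.sphere 0 1 ⊆
      Metric.closedBall (EuclideanSpace.single j (1 : ℝ)) ε := by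
  intro u hu
  obtain ⟨w, rfl, hw⟩ := exists_sphereGraph_eq j hδn hu
  rw [mem_closedBall_iff_norm]
  have heq : sphereGraph j w - EuclideanSpace.single j (1 : ℝ) =
      EuclideanSpace.single j (√(1 - ‖w‖ ^ 2) - 1) + (w : E n) := by
    ext k
    simp only [sphereGraph, PiLp.sub_apply, PiLp.add_apply, PiLp.single_apply]
    split_ifs <;> ring
  refine abs_le_of_sq_le_sq' ?_ hε |>.2
  rw [heq, norm_single_add_sq]
  have hs := Real.sq_sqrt (show 0 ≤ 1 - ‖w‖ ^ 2 by linarith)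
  have hs0 := Real.sqrt_nonneg (1 - ‖w‖ ^ 2)
  have hs1 : √(1 - ‖w‖ ^ 2) ≤ 1 := Real.sqrt_le_one.2 (by nlinarith [sq_nonneg ‖w‖])
  nlinarith

theorem hausdorff_coordCone_ne_top (hδn : 2 * (n * δ ^ 2) ≤ 1) :
    μHE[n - j - 1] (coordCone j δ ∩ Metric.sphere 0 1) ≠ ⊤ := by
  have hd : Module.finrank ℝ (coordSub (Finset.Ioi j)) = n - j - 1 := by
    rw [finrank_coordSub, Fin.card_Ioi]
    omega
  rw [euclideanHausdorff_ne_top_iff]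
  have hsub : coordCone j δ ∩ Metric.sphere 0 1 ⊆ sphereGraph j '' {w | ‖w‖ ^ 2 ≤ 1 / 2} := by
    intro u hu
    obtain ⟨w, rfl, hw⟩ := exists_sphereGraph_eq j hδn hu
    exact ⟨w, by simp only [Set.mem_ofPred_eq]; linarith, rfl⟩
  have hball : μHE[n - j - 1] {w : coordSub (Finset.Ioi j) | ‖w‖ ^ 2 ≤ 1 / 2} ≠ ⊤ := by
    rw [← hd]
    refine ((measure_mono ?_).trans_lt (measure_closedBall_lt_top (x := 0) (r := 1))).ne
    intro w hw
    rw [mem_closedBall_zero_iff]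
    have : ‖w‖ ^ 2 ≤ 1 / 2 := hw
    nlinarith [norm_nonneg w]
  rw [euclideanHausdorff_ne_top_iff] at hball
  have hle := (lipschitzOnWith_sphereGraph j).hausdorffMeasure_image_le
    (d := ((n - j - 1 : ℕ) : ℝ)) (by positivity)
  refine ((measure_mono hsub).trans_lt (hle.trans_lt ?_)).ne
  exact ENNReal.mul_lt_top (ENNReal.rpow_lt_top_of_nonneg (by positivity) (by simp))
    hball.lt_top

theorem hausdorff_coordCone_ne_zero (hδ : 0 < δ) (hδ1 : δ ≤ 1) :
    μHE[n - j - 1] (coordCone j δ ∩ Metric.sphere 0 1) ≠ 0 := by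
  have hd : Module.finrank ℝ (coordSub (Finset.Ioi j)) = n - j - 1 := by
    rw [finrank_coordSub, Fin.card_Ioi]
    omega
  have hsub : Metric.closedBall (0 : coordSub (Finset.Ioi j)) (δ / 2) ⊆
      (coordSub (Finset.Ioi j)).orthogonalProjectionOnto ''
        (coordCone j δ ∩ Metric.sphere 0 1) := by
    intro w hw
    rw [mem_closedBall_zero_iff] at hw
    have hs : 1 / 2 ≤ √(1 - ‖w‖ ^ 2) :=
      Real.le_sqrt_of_sq_le (by nlinarith [norm_nonneg w])
    refine ⟨sphereGraph j w, ⟨⟨fun i hi => ?_, ?_, fun k hk => ?_⟩, ?_⟩, ?_⟩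
    · rw [sphereGraph_of_ne j hi.ne, coordSub_Ioi_apply j hi.le]
    · rw [sphereGraph_self]
      positivity
    · rw [sphereGraph_of_ne j hk.ne', sphereGraph_self]
      have : |(w : E n) k| ≤ ‖(w : E n)‖ := PiLp.norm_apply_le (w : E n) k
      rw [← Submodule.coe_norm] at this
      nlinarith
    · exact mem_sphere_zero_iff_norm.2 (norm_sphereGraph j (by linarith))
    · ext1
      rw [← Submodule.starProjection_apply, starProjection_coordSub]
      ext k
      by_cases hk : j < k
      · simp [hk, sphereGraph_of_ne j hk.ne']
      · simp [hk, coordSub_Ioi_apply j (not_lt.1 hk) w]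
  have hball : μHE[n - j - 1] (Metric.closedBall (0 : coordSub (Finset.Ioi j)) (δ / 2)) ≠ 0 := by
    rw [← hd]
    exact (Metric.measure_closedBall_pos _ _ (half_pos hδ)).ne'
  rw [euclideanHausdorff_ne_zero_iff] at hball ⊢
  refine fun h => hball (measure_mono_null hsub (le_antisymm ?_ zero_le))
  rw [← h]
  exact hausdorffMeasure_orthogonalProjectionOnto_le _ _ _ (by positivity)

theorem isClosed_coordCone : IsClosed (coordCone j δ) := by
  have : coordCone j δ = ⋂ g ∈ conePts j δ, {u : E n | ⟪u, g⟫ ≤ 0} := by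
    ext u
    simp [mem_coordCone_iff]
  rw [this]
  exact isClosed_biInter fun g _ => isClosed_le (by fun_prop) continuous_const

end Graph

section Ball

variable {n : ℕ} (y : E n)

open Classical in
/-- A cross-polytope centred at `y`. -/
noncomputable def crossPolytope : Polytope n :=
  hullAt y ({0} ∪ Finset.univ.image (fun i => EuclideanSpace.single i (1 : ℝ)) ∪
    Finset.univ.image (fun i => -EuclideanSpace.single i (1 : ℝ))) ⟨0, by simp⟩

theorem add_mem_crossPolytope (hn : 0 < n) {w : E n} (hw : ‖w‖ ≤ 1 / n) :
    y + w ∈ (crossPolytope y).1 := by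
  refine mem_of_convex_of_coordSub (s := Finset.univ) (C := {w | y + w ∈ (crossPolytope y).1}) hn
    (Convex.translate_preimage_right (convex_convexHull ℝ _) y) ?_ ?_ ?_
    (mem_coordSub.2 fun i hi => absurd (Finset.mem_univ i) hi) hw
  · exact add_mem_hullAt y ⟨0, by simp⟩ (by simp)
  · exact fun i _ => add_mem_hullAt y ⟨0, by simp⟩ (by simp)
  · exact fun i _ => add_mem_hullAt y ⟨0, by simp⟩ (by simp)

theorem direction_crossPolytope (hn : 0 < n) :
    (affineSpan ℝ (crossPolytope y).1).direction = ⊤ :=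
  direction_eq_of_ball_subset (ρ := 1 / n) (by positivity) (fun _ _ => Submodule.mem_top)
    fun _ _ h => add_mem_crossPolytope y hn h

theorem crossPolytope_mem_faces (hn : 0 < n) :
    (crossPolytope y).1 ∈ faces (crossPolytope y).1 n := by
  refine ⟨⟨_, add_mem_crossPolytope y hn (w := 0) (by simp)⟩, convex_convexHull ℝ _,
    IsExtreme.rfl, ?_⟩
  rw [direction_crossPolytope y hn, finrank_top, finrank_euclideanSpace_fin]

end Ball

theorem tensCurvMeasure_of_lt {n j r s l : ℕ} (hj : j < n) (P : Polytope n) (β : Set (E n)) :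
    tensCurvMeasure j r s l P β = faceMeasure j r s l P β := by
  cases s <;> simp [tensCurvMeasure, hj]

theorem tensCurvMeasure_top {n r l : ℕ} (P : Polytope n) (β : Set (E n)) :
    tensCurvMeasure n r 0 l P β = volMeasure r l P β := by
  simp [tensCurvMeasure]

theorem diag_volMeasure {n r l : ℕ} (P : Polytope n) (β : Set (E n)) (v : E n) :
    diag v (volMeasure r l P β) = 1 / (r ! : ℝ) * (sphereVol (n + 2 * l) / sphereVol n) *
      ((‖v‖ ^ 2) ^ l * diag v (∫ x in P.1 ∩ β, vecPow x r ∂μHE[n])) := by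
  rw [volMeasure, map_smul, smul_eq_mul, diag_symMul, diag_symPow, diag_metricTensor]

theorem diag_tensCurvMeasure_top {n r l : ℕ} (P : Polytope n) (β : Set (E n)) (v : E n) :
    diag v (tensCurvMeasure n r 0 l P β) =
      1 / (r ! : ℝ) * (sphereVol (n + 2 * l) / sphereVol n) *
        ((‖v‖ ^ 2) ^ l * diag v (∫ x in P.1 ∩ β, vecPow x r ∂μHE[n])) := by
  rw [tensCurvMeasure_top]
  exact diag_volMeasure P β v

theorem diag_tensCurvMeasure_of_ne {n j k r s l : ℕ} {P : Polytope n} {F β : Set (E n)}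
    (hF : F ∈ faces P.1 j) (hβ : ∀ x ∈ β, IsRelInterior F x) (htop : μHE[j] β ≠ ⊤)
    (hkn : k ≤ n) (hs : k = n → s = 0) (hk : k ≠ j) (v : E n) :
    diag v (tensCurvMeasure k r s l P β) = 0 := by
  rcases hkn.lt_or_eq with hlt | rfl
  · rw [tensCurvMeasure_of_lt hlt, diag_faceMeasure_of_ne hF hβ htop hk]
  · obtain rfl := hs rfl
    have hjk : j < k := by
      refine lt_of_le_of_ne ?_ hk.symm
      rw [← hF.2.2.2]
      exact (Submodule.finrank_le _).trans finrank_euclideanSpace_fin.le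
    have h0 : μHE[k] (P.1 ∩ β) = 0 := measure_mono_null Set.inter_subset_right
      ((Measure.euclideanHausdorffMeasure_zero_or_top hjk β).resolve_right htop)
    rw [diag_tensCurvMeasure_top, setIntegral_measure_zero _ h0, map_zero, mul_zero, mul_zero]

theorem diag_metricTensCurv {n p : ℕ} (i : Index n p) (P : Polytope n)
    (β : {β : Set (E n) // MeasurableSet β}) (v : E n) :
    diag v (metricTensCurv i P β) =
      (‖v‖ ^ 2) ^ i.m * diag v (tensCurvMeasure i.j i.r i.s i.l P β.1) := by
  rw [metricTensCurv, diag_rankCast, diag_symMul, diag_symPow, diag_metricTensor]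

/-- A linear relation localizes to the indices `i` with `i.j = j`. -/
theorem sum_filter_diag_eq_zero {n p j : ℕ} {T : Finset (Index n p)} {g : Index n p → ℝ}
    (h : ∀ P β v, ∑ i ∈ T, g i * diag v (metricTensCurv i P β) = 0) {P : Polytope n} {F β : Set (E n)}
    (hF : F ∈ faces P.1 j) (hβm : MeasurableSet β) (hβ : ∀ x ∈ β, IsRelInterior F x)
    (htop : μHE[j] β ≠ ⊤) (v : E n) :
    ∑ i ∈ T with i.j = j,
      g i * ((‖v‖ ^ 2) ^ i.m * diag v (tensCurvMeasure i.j i.r i.s i.l P β)) = 0 := by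
  have h1 := h P ⟨β, hβm⟩ v
  simp only [diag_metricTensCurv] at h1
  rw [← h1, Finset.sum_filter]
  refine Finset.sum_congr rfl fun i _ => ?_
  split_ifs with hi
  · rfl
  · rw [diag_tensCurvMeasure_of_ne hF hβ htop i.j_le (fun h => (i.top_eq_zero h).1) hi, mul_zero,
      mul_zero]

theorem isRelInterior_flatBall {n : ℕ} {F : Set (E n)} {L : Submodule ℝ (E n)} {y : E n}
    {ρ ε : ℝ} (hρ : 0 < ρ) (hε : ε ≤ ρ / 2) (hFL : ∀ x ∈ F, x - y ∈ L)
    (hLF : ∀ w ∈ L, ‖w‖ ≤ ρ → y + w ∈ F) : ∀ x ∈ flatBall L y ε, IsRelInterior F x := by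
  rintro _ ⟨w, hw, rfl⟩
  exact isRelInterior_of_ball_subset hρ hFL hLF w.2 ((mem_closedBall_zero_iff.1 hw).trans hε)

theorem tendsto_shrink (n : ℕ) :
    Tendsto (fun k : ℕ => 1 / (2 * (n : ℝ)) * (1 / ((k : ℝ) + 1))) atTop (𝓝 0) := by
  simpa using (tendsto_one_div_add_atTop_nhds_zero_nat (𝕜 := ℝ)).const_mul (1 / (2 * (n : ℝ)))

theorem shrink_pos {n : ℕ} (hn : 0 < n) (k : ℕ) :
    0 < 1 / (2 * (n : ℝ)) * (1 / ((k : ℝ) + 1)) := by positivity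

theorem shrink_le {n : ℕ} (hn : 0 < n) (k : ℕ) :
    1 / (2 * (n : ℝ)) * (1 / ((k : ℝ) + 1)) ≤ 1 / n / 2 := by
  have : 1 / ((k : ℝ) + 1) ≤ 1 := by
    rw [div_le_one (by positivity)]
    linarith [k.cast_nonneg (α := ℝ)]
  calc _ ≤ 1 / (2 * (n : ℝ)) * 1 := by gcongr
    _ = 1 / n / 2 := by field_simp

theorem limit_relation_of_lt {n p : ℕ} (j : Fin n) {T : Finset (Index n p)}
    {g : Index n p → ℝ} (h : ∀ P β v, ∑ i ∈ T, g i * diag v (metricTensCurv i P β) = 0) (v y : E n) :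
    ∑ i ∈ T with i.j = (j : ℕ),
      g i * (normConst n j i.r i.s i.l * (1 / sphereVol (n - j))) *
        ((‖v‖ ^ 2) ^ i.m * (‖(coordSub (Finset.Iio j)).starProjection v‖ ^ 2) ^ i.l *
          ⟪y, v⟫ ^ i.r * v j ^ i.s) = 0 := by
  have hn : 0 < n := j.pos
  have hn1 : (1 : ℝ) ≤ n := by exact_mod_cast hn
  set L := coordSub (Finset.Iio j) with hL
  have hLj : Module.finrank ℝ L = j := by rw [hL, finrank_coordSub, Fin.card_Iio]
  set ε : ℕ → ℝ := fun k => 1 / (2 * (n : ℝ)) * (1 / ((k : ℝ) + 1))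
  have hε0 : ∀ k, 0 < ε k := shrink_pos hn
  have hεn : ∀ k, ε k ≤ 1 / n / 2 := shrink_le hn
  have hεt : Tendsto ε atTop (𝓝 0) := tendsto_shrink n
  set δ : ℕ → ℝ := fun k => ε k / (2 * n)
  have hδ0 : ∀ k, 0 < δ k := fun k => div_pos (hε0 k) (by positivity)
  have hε1 : ∀ k, ε k ≤ 1 := fun k => (hεn k).trans (by
    rw [div_div, div_le_one (by positivity)]
    linarith)
  have hδε : ∀ k, 2 * (n * δ k ^ 2) ≤ ε k ^ 2 := fun k => by
    have : 2 * (n * δ k ^ 2) = ε k ^ 2 / (2 * n) := by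
      simp only [δ]
      field_simp
    rw [this]
    exact div_le_self (sq_nonneg _) (by linarith)
  have hδ1 : ∀ k, 2 * (n * δ k ^ 2) ≤ 1 := fun k =>
    (hδε k).trans (pow_le_one₀ (hε0 k).le (hε1 k))
  have hδle : ∀ k, δ k ≤ 1 := fun k => (div_le_self (hε0 k).le (by linarith)).trans (hε1 k)
  set β : ℕ → Set (E n) := fun k => flatBall L y (ε k)
  set N : ℕ → Set (E n) := fun k => coordCone j (δ k) ∩ Metric.sphere 0 1
  have hβm : ∀ k, MeasurableSet (β k) := fun k => (isCompact_flatBall L y (ε k)).measurableSet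
  have hNm : ∀ k, MeasurableSet (N k) := fun k =>
    ((isClosed_coordCone j).inter Metric.isClosed_sphere).measurableSet
  have hβ0 : ∀ k, μHE[j] (β k) ≠ 0 := fun k => hausdorff_flatBall_ne_zero L y (ε k) hLj (hε0 k)
  have hβt : ∀ k, μHE[j] (β k) ≠ ⊤ := fun k => hausdorff_flatBall_ne_top L y (ε k) hLj
  have hN0 : ∀ k, μHE[n - j - 1] (N k) ≠ 0 := fun k =>
    hausdorff_coordCone_ne_zero j (hδ0 k) (hδle k)
  have hNt : ∀ k, μHE[n - j - 1] (N k) ≠ ⊤ := fun k =>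
    hausdorff_coordCone_ne_top j (hδ1 k)
  have hrel : ∀ k, ∀ x ∈ β k, IsRelInterior (coneFace y j (δ k)) x := fun k =>
    isRelInterior_flatBall (ρ := 1 / n) (by positivity) (hεn k)
      (fun x hx => coneFace_sub_mem y j (hδ0 k) hx) fun w hw hw' => add_mem_coneFace y j hw hw'
  have hI (r : ℕ) : Tendsto (fun k => diag v ((μHE[j] (β k)).toReal⁻¹ •
      ∫ x in β k, vecPow x r ∂μHE[j])) atTop (𝓝 (⟪y, v⟫ ^ r)) := by
    rw [← diag_vecPow]
    exact ((diag v).continuous.tendsto _).comp (tendsto_average_of_shrinking (fun _ => μHE[j])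
      β hβm y ε hεt (fun k => flatBall_subset L y (ε k)) hβ0 hβt _ (continuous_vecPow r))
  have hJ (s : ℕ) : Tendsto (fun k => diag v ((μHE[n - j - 1] (N k)).toReal⁻¹ •
      ∫ u in N k, vecPow u s ∂μHE[n - j - 1])) atTop (𝓝 (v j ^ s)) := by
    rw [← one_mul (v j), ← inner_single_left, ← diag_vecPow]
    exact ((diag v).continuous.tendsto _).comp (tendsto_average_of_shrinking
      (fun _ => μHE[n - j - 1]) N hNm _ ε hεt
      (fun k => coordCone_subset_closedBall j (hε0 k).le (hδ1 k) (hδε k))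
      hN0 hNt _ (continuous_vecPow s))
  refine tendsto_nhds_unique (tendsto_finsetSum _ fun i _ => ((hI i.r).const_mul
    ((‖v‖ ^ 2) ^ i.m * (‖L.starProjection v‖ ^ 2) ^ i.l) |>.mul (hJ i.s)).const_mul
      (g i * (normConst n j i.r i.s i.l * (1 / sphereVol (n - j))))) ?_
  refine tendsto_const_nhds.congr fun k => ?_
  have hk := sum_filter_diag_eq_zero h (coneFace_mem_faces y j (hδ0 k)) (hβm k) (hrel k) (hβt k) v
  rw [← mul_zero ((μHE[j] (β k)).toReal⁻¹ * (μHE[n - j - 1] (N k)).toReal⁻¹), ← hk,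
    Finset.mul_sum]
  refine Finset.sum_congr rfl fun i hi => ?_
  rw [(Finset.mem_filter.1 hi).2, tensCurvMeasure_of_lt j.2,
    diag_faceMeasure_self (coneFace_mem_faces y j (hδ0 k)) (hrel k) (hβt k),
    direction_coneFace y j (hδ0 k), normalCone_coneFace y j (hδ0 k), map_smul, map_smul,
    smul_eq_mul, smul_eq_mul]
  ring

theorem limit_relation_top {n p : ℕ} (hn : 0 < n) {T : Finset (Index n p)}
    {g : Index n p → ℝ} (h : ∀ P β v, ∑ i ∈ T, g i * diag v (metricTensCurv i P β) = 0) (v y : E n) :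
    ∑ i ∈ T with i.j = n,
      g i * (1 / (i.r ! : ℝ)) * ((‖v‖ ^ 2) ^ i.m * ⟪y, v⟫ ^ i.r) = 0 := by
  have hLn : Module.finrank ℝ (⊤ : Submodule ℝ (E n)) = n := by
    rw [finrank_top, finrank_euclideanSpace_fin]
  set ε : ℕ → ℝ := fun k => 1 / (2 * (n : ℝ)) * (1 / ((k : ℝ) + 1))
  set β : ℕ → Set (E n) := fun k => flatBall ⊤ y (ε k)
  have hβm : ∀ k, MeasurableSet (β k) := fun k => (isCompact_flatBall ⊤ y (ε k)).measurableSet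
  have hβ0 : ∀ k, μHE[n] (β k) ≠ 0 := fun k =>
    hausdorff_flatBall_ne_zero ⊤ y (ε k) hLn (shrink_pos hn k)
  have hβt : ∀ k, μHE[n] (β k) ≠ ⊤ := fun k => hausdorff_flatBall_ne_top ⊤ y (ε k) hLn
  have hrel : ∀ k, ∀ x ∈ β k, IsRelInterior (crossPolytope y).1 x := fun k =>
    isRelInterior_flatBall (ρ := 1 / n) (by positivity) (shrink_le hn k)
      (fun x _ => Submodule.mem_top) fun w _ hw => add_mem_crossPolytope y hn hw
  have hI (r : ℕ) : Tendsto (fun k => diag v ((μHE[n] (β k)).toReal⁻¹ •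
      ∫ x in β k, vecPow x r ∂μHE[n])) atTop (𝓝 (⟪y, v⟫ ^ r)) := by
    rw [← diag_vecPow]
    exact ((diag v).continuous.tendsto _).comp (tendsto_average_of_shrinking (fun _ => μHE[n])
      β hβm y ε (tendsto_shrink n) (fun k => flatBall_subset ⊤ y (ε k)) hβ0 hβt _
      (continuous_vecPow r))
  refine tendsto_nhds_unique (tendsto_finsetSum _ fun i _ => ((hI i.r).const_mul
    ((‖v‖ ^ 2) ^ i.m)).const_mul (g i * (1 / (i.r ! : ℝ)))) ?_
  refine tendsto_const_nhds.congr fun k => ?_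
  have hk := sum_filter_diag_eq_zero h (crossPolytope_mem_faces y hn) (hβm k) (hrel k) (hβt k) v
  rw [← mul_zero ((μHE[n] (β k)).toReal⁻¹), ← hk, Finset.mul_sum]
  refine Finset.sum_congr rfl fun i hi => ?_
  have hin : i.j = n := (Finset.mem_filter.1 hi).2
  obtain ⟨hs, hl⟩ := i.top_eq_zero hin
  have hPβ : (crossPolytope y).1 ∩ β k = β k := Set.inter_eq_right.2 fun x hx => (hrel k x hx).1
  rw [hin, hs, hl, diag_tensCurvMeasure_top, hPβ, mul_zero, add_zero,
    div_self (sphereVol_ne_zero hn), map_smul, smul_eq_mul]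
  ring

theorem norm_single_add_single_sq {n : ℕ} {i k : Fin n} (h : i ≠ k) (a b : ℝ) :
    ‖EuclideanSpace.single i a + EuclideanSpace.single k b‖ ^ 2 = a ^ 2 + b ^ 2 := by
  rw [norm_add_sq_real, inner_single_left]
  simp [h]

/-- The quantities `‖v‖²`, `‖p_L v‖²` and `vⱼ` can be prescribed. -/
theorem exists_vector {n : ℕ} (hn : 2 ≤ n) (j : Fin n) {M A B : ℝ} (hA : 0 ≤ A)
    (hM : A + B ^ 2 ≤ M) : ∃ v : E n, ‖v‖ ^ 2 = M ∧ v j = B ∧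
      (0 < (j : ℕ) → (j : ℕ) + 1 < n →
        ‖(coordSub (Finset.Iio j)).starProjection v‖ ^ 2 = A) := by
  by_cases hj : 0 < (j : ℕ) ∧ (j : ℕ) + 1 < n
  · have h0 : (⟨0, by omega⟩ : Fin n) < j := hj.1
    have h1 : j < (⟨n - 1, by omega⟩ : Fin n) := Fin.lt_def.2 (by simp only; omega)
    set i0 : Fin n := ⟨0, by omega⟩
    set i1 : Fin n := ⟨n - 1, by omega⟩
    have hp : (coordSub (Finset.Iio j)).starProjection (EuclideanSpace.single i0 (√A) +
        EuclideanSpace.single j B + EuclideanSpace.single i1 √(M - A - B ^ 2)) =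
        EuclideanSpace.single i0 (√A) := by
      rw [starProjection_coordSub]
      ext k
      by_cases hk : k < j
      · simp [hk, hk.ne, (hk.trans h1).ne]
      · have : k ≠ i0 := fun h => hk (h ▸ h0)
        simp [hk, this]
    refine ⟨_, ?_, ?_, fun _ _ => by
      rw [hp, PiLp.norm_single, Real.norm_eq_abs, sq_abs, Real.sq_sqrt hA]⟩
    · rw [norm_add_sq_real, inner_single_right, norm_single_add_single_sq h0.ne, PiLp.norm_single,
        Real.norm_eq_abs, sq_abs, Real.sq_sqrt hA, Real.sq_sqrt (by linarith)]
      simp [h1.ne', (h0.trans h1).ne']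
    · simp [h0.ne', h1.ne]
  · have : Nontrivial (Fin n) := Fin.nontrivial_iff_two_le.2 hn
    obtain ⟨k, hk⟩ := exists_ne j
    refine ⟨EuclideanSpace.single j B + EuclideanSpace.single k √(M - B ^ 2), ?_, ?_,
      fun h h' => absurd ⟨h, h'⟩ hj⟩
    · rw [norm_single_add_single_sq hk.symm, Real.sq_sqrt (by linarith)]
      ring
    · simp [hk.symm]

/-- The exponents of the monomial attached to an index. -/
noncomputable def Index.exponents {n p : ℕ} (i : Index n p) : Fin 4 →₀ ℕ :=
  Finsupp.equivFunOnFinite.symm ![i.m, i.l, i.r, i.s]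

theorem Index.eq_of_exponents {n p : ℕ} {i k : Index n p} (hj : i.j = k.j)
    (h : i.exponents = k.exponents) : i = k := by
  have h' := Finsupp.equivFunOnFinite.symm.injective h
  have h0 := congrFun h' 0
  have h1 := congrFun h' 1
  have h2 := congrFun h' 2
  have h3 := congrFun h' 3
  cases i
  cases k
  simp_all

theorem relation_monomials {n p : ℕ} (hn : 2 ≤ n) {T : Finset (Index n p)}
    {g : Index n p → ℝ} (h : ∀ P β v, ∑ i ∈ T, g i * diag v (metricTensCurv i P β) = 0) {j : ℕ} (hj : j ≤ n) :
    ∃ c : Index n p → ℝ, (∀ i, c i ≠ 0) ∧ ∀ M A X B : ℝ, M ∈ Set.Icc 2 3 → A ∈ Set.Icc 0 1 →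
      B ∈ Set.Icc 0 1 →
      ∑ i ∈ T with i.j = j, g i * c i * (M ^ i.m * A ^ i.l * X ^ i.r * B ^ i.s) = 0 := by
  have hy {M X : ℝ} (hM : 2 ≤ M) {v : E n} (hv : ‖v‖ ^ 2 = M) : ⟪(X / M) • v, v⟫ = X := by
    rw [real_inner_smul_left, real_inner_self_eq_norm_sq, hv, div_mul_cancel₀]
    linarith
  rcases hj.lt_or_eq with hlt | rfl
  · refine ⟨fun i => normConst n j i.r i.s i.l * (1 / sphereVol (n - j)), fun i =>
      mul_ne_zero (normConst_ne_zero hlt _ _ _)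
        (one_div_ne_zero (sphereVol_ne_zero (by omega))), ?_⟩
    intro M A X B hM hA hB
    obtain ⟨v, hvM, hvB, hvA⟩ := exists_vector (M := M) hn ⟨j, hlt⟩ (B := B) hA.1
      (by nlinarith [hM.1, hA.2, hB.1, hB.2])
    have hlim := limit_relation_of_lt ⟨j, hlt⟩ h v ((X / M) • v)
    rw [← hlim]
    refine Finset.sum_congr rfl fun i hi => ?_
    have hij : i.j = j := (Finset.mem_filter.1 hi).2
    rw [hvM, hvB, hy hM.1 hvM]
    by_cases hdeg : i.j = 0 ∨ i.j + 1 = n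
    · simp [i.l_eq_zero hdeg]
    · rw [hvA (by simp only; omega) (by simp only; omega)]
  · refine ⟨fun i => 1 / (i.r ! : ℝ), fun i => by positivity, ?_⟩
    intro M A X B hM hA hB
    obtain ⟨v, hvM, -, -⟩ := exists_vector (M := M) hn ⟨0, by omega⟩ (B := B) hA.1
      (by nlinarith [hM.1, hA.2, hB.1, hB.2])
    rw [← limit_relation_top (by omega) h v ((X / M) • v)]
    refine Finset.sum_congr rfl fun i hi => ?_
    obtain ⟨hs, hl⟩ := i.top_eq_zero (Finset.mem_filter.1 hi).2
    rw [hvM, hy hM.1 hvM, hs, hl, pow_zero, pow_zero, mul_one, mul_one]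

end TensorCurv

open TensorCurv in
theorem theorem5p1 (n p : ℕ) (hn : 2 ≤ n) :
    LinearIndependent ℝ
      (TensorCurv.metricTensCurv : TensorCurv.Index n p → TensorCurv.Polytope n →
        {β : Set (TensorCurv.E n) // MeasurableSet β} → TensorCurv.SymTensor n p) := by
  rw [linearIndependent_iff'ₛ]
  intro T g₁ g₂ h₁₂ i hi
  set g := g₁ - g₂ with hg
  have h : ∀ P β v, ∑ i ∈ T, g i * diag v (metricTensCurv i P β) = 0 := by
    intro P β v
    have hPβ := congrArg (diag v) (congrFun (congrFun h₁₂ P) β)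
    simp only [Finset.sum_apply, Pi.smul_apply, map_sum, map_smul, smul_eq_mul] at hPβ
    simp only [hg, Pi.sub_apply, sub_mul, Finset.sum_sub_distrib, hPβ, sub_self]
  rw [← sub_eq_zero]
  change g i = 0
  obtain ⟨c, hc, hrel⟩ := relation_monomials hn h i.j_le
  have hinf (a b : ℝ) (hab : a < b) : (Set.Icc a b).Infinite := Set.Icc_infinite hab
  have hz := coeff_eq_zero_of_sum_monomial_eq_zero (T.filter fun k => k.j = i.j)
    Index.exponents (fun a ha b hb hab => Index.eq_of_exponents
      ((Finset.mem_filter.1 ha).2.trans (Finset.mem_filter.1 hb).2.symm) hab)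
    (fun k => g k * c k) ![Set.Icc 2 3, Set.Icc 0 1, Set.univ, Set.Icc 0 1]
    (by
      intro k
      fin_cases k
      · exact hinf 2 3 (by norm_num)
      · exact hinf 0 1 one_pos
      · exact Set.infinite_univ
      · exact hinf 0 1 one_pos)
    (fun x hx => by
      rw [← hrel (x 0) (x 1) (x 2) (x 3) (hx 0) (hx 1) (hx 3)]
      refine Finset.sum_congr rfl fun k _ => ?_
      rw [Fin.prod_univ_four]
      rfl)
    i (Finset.mem_filter.2 ⟨hi, rfl⟩)
  exact (mul_eq_zero.1 hz).resolve_right (hc i)
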